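/- Let $\Omega\subset\mathbb{R}^d$ be open and bounded, let $h:\mathbb{R}^n\to\mathbb{R}$ be convex, and suppose that for some $p\ge 1$ and $c>0$ $$h(\lambda)\ \ge\ \frac1c|\lambda|^p-c\qquad\text{for all }\lambda\in\mathbb{R}^n .$$ Let $u_j:\Omega\to\mathbb{R}^n$, $j\in\mathbb{N}$, be measurable functions with $\sup_j\int_\Omega h(u_j)\,\mathrm{d}x<\infty$. Then there exist a subsequence $\{u_{j_k}\}$, a measurable family $\{\nu_x\}_{x\in\Omega}$ of Borel probability measures on $\mathbb{R}^n$ (a Young measure) and a finite nonnegative Borel measure $\mu$ on $\overline\Omega$ (the concentration measure) such that: 1. for every continuous $f:\mathbb{R}^n\to\mathbb{R}$ with $\lim_{|\lambda|\to\infty}\frac{|f(\lambda)|}{1+|\lambda|^p}=0$, the function $f$ is $\nu_x$-integrable for a.e. $x\in\Omega$, and $$f(u_{j_k})\ \rightharpoonup\ \int f(\lambda)\,\mathrm{d}\nu_x(\lambda)\qquad\text{weakly in }L^1(\Omega);$$ 2. $h$ is $\nu_x$-integrable for a.e. $x\in\Omega$, the function $x\mapsto\int h(\lambda)\,\mathrm{d}\nu_x(\lambda)$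 belongs to $L^1(\Omega)$, and for every $\varphi\in C(\overline\Omega)$ $$\int_\Omega h(u_{j_k})\,\varphi\,\mathrm{d}x\ \longrightarrow\ \int_\Omega\Big(\int h(\lambda)\,\mathrm{d}\nu_x(\lambda)\Big)\varphi\,\mathrm{d}x+\int_{\overline\Omega}\varphi\,\mathrm{d}\mu\qquad\text{as }k\to\infty .$$ -/

import Mathlib

open MeasureTheory ProbabilityTheory Filter Topology

/-- Weak convergence `F k ⇀ G` in `L¹(m)`: all the functions lie in `L¹(m)` and the
convergence is tested against the dual space `L^∞(m)`. -/
def WeaklyConvergesInL1 {X : Type*} [MeasurableSpace X] (m : Measure X)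
    (F : ℕ → X → ℝ) (G : X → ℝ) : Prop :=
  (∀ k, Integrable (F k) m) ∧ Integrable G m ∧
    ∀ g : X → ℝ, MemLp g ⊤ m →
      Tendsto (fun k => ∫ x, F k x * g x ∂m) atTop (𝓝 (∫ x, G x * g x ∂m))

/-! Let `m` be Lebesgue measure on `Ω` and push it forward to the graphs `x ↦ (x, u j x)`. The
resulting measures `π j` on the product all have first marginal `m`, and the growth of `h` bounds
their integrals of `W = 1 + ‖y‖ ^ p`. Hence they are tight, and Prokhorov's theorem
(`exists_subseq_weak_limit`) gives a weak limit `ρ`, again with first marginal `m`. Its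
disintegration is the Young measure.

A function of growth lower than `W` is uniformly close, relative to `W`, to a bounded truncation, so
its integrals converge to those against `ρ`. Because the first marginal is fixed, factors in `x`
need only be bounded and measurable (`tendsto_integral_of_lower_growth`).

The integrand `h` itself may lose mass at infinity. With `H = h + c ≥ 0`, the marginals in `x` of `H
dπ j` have bounded mass on `closure Ω` and subconverge to a measure `τ`. Lower semicontinuity shows
that `τ` dominates the marginal of `H dρ`; the difference is the concentration measure
(`exists_concentration_measure`). -/

open scoped BoundedContinuousFunction NNReal ENNReal

/-! ### Weak limits of finite measures -/

section WeakLimits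

variable {X : Type*} [TopologicalSpace X] [MeasurableSpace X]

/-- Along a weakly convergent sequence of finite measures, the integral of a nonnegative continuous
function is lower semicontinuous. -/
lemma integrable_and_integral_le_of_weak_limit [OpensMeasurableSpace X]
    {π : ℕ → Measure X} [∀ k, IsFiniteMeasure (π k)] {ρ : Measure X} [IsFiniteMeasure ρ]
    (hπ : ∀ f : X →ᵇ ℝ, Tendsto (fun k => ∫ z, f z ∂π k) atTop (𝓝 (∫ z, f z ∂ρ)))
    {F : X → ℝ} (hF : Continuous F) (h0 : ∀ z, 0 ≤ F z) (hint : ∀ k, Integrable F (π k))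
    {C : ℕ → ℝ} {a : ℝ} (hC : Tendsto C atTop (𝓝 a)) (hle : ∀ k, ∫ z, F z ∂π k ≤ C k) :
    Integrable F ρ ∧ ∫ z, F z ∂ρ ≤ a := by
  -- The cut-offs `min F N` are admissible test functions, so their limit integrals stay below `a`;
  -- they increase to `F`.
  let T : ℕ → X →ᵇ ℝ := fun N => BoundedContinuousFunction.ofNormedAddCommGroup
    (fun z => min (F z) N) (by fun_prop) N (fun z => by
      rw [Real.norm_of_nonneg (le_min (h0 z) (Nat.cast_nonneg N))]; exact min_le_right _ _)
  have hT : ∀ N z, T N z = min (F z) N := fun N z => rfl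
  have hT0 : ∀ N z, 0 ≤ T N z := fun N z => le_min (h0 z) (Nat.cast_nonneg N)
  have hTa : ∀ N, ∫ z, T N z ∂ρ ≤ a := fun N =>
    le_of_tendsto_of_tendsto' (hπ (T N)) hC fun k =>
      (integral_mono ((T N).integrable _) (hint k) fun z => min_le_left _ _).trans (hle k)
  have hlim : Tendsto (fun N => ∫⁻ z, ENNReal.ofReal (T N z) ∂ρ) atTop
      (𝓝 (∫⁻ z, ENNReal.ofReal (F z) ∂ρ)) := by
    refine lintegral_tendsto_of_tendsto_of_monotone (fun N => ?_) (.of_forall fun z => ?_)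
      (.of_forall fun z => ?_)
    · exact (T N).continuous.measurable.ennreal_ofReal.aemeasurable
    · intro M N hMN
      exact ENNReal.ofReal_le_ofReal (min_le_min_left _ (by exact_mod_cast hMN))
    · refine tendsto_const_nhds.congr' ?_
      obtain ⟨N₀, hN₀⟩ := exists_nat_ge (F z)
      filter_upwards [eventually_ge_atTop N₀] with N hN
      rw [hT, min_eq_left (hN₀.trans (by exact_mod_cast hN))]
  have hle' : ∫⁻ z, ENNReal.ofReal (F z) ∂ρ ≤ ENNReal.ofReal a := by
    refine le_of_tendsto' hlim fun N => ?_
    rw [← ofReal_integral_eq_lintegral_ofReal ((T N).integrable _) (.of_forall (hT0 N))]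
    exact ENNReal.ofReal_le_ofReal (hTa N)
  have ha : 0 ≤ a := (integral_nonneg (hT0 0)).trans (hTa 0)
  have hI : Integrable F ρ := by
    refine ⟨hF.measurable.aestronglyMeasurable, ?_⟩
    rw [hasFiniteIntegral_iff_ofReal (.of_forall h0)]
    exact hle'.trans_lt ENNReal.ofReal_lt_top
  refine ⟨hI, ?_⟩
  rw [integral_eq_lintegral_of_nonneg_ae (.of_forall h0) hI.1]
  exact ENNReal.toReal_le_of_le_ofReal ha hle'

omit [TopologicalSpace X] in
-- An error of at most `ε * W` costs at most `ε * M` in each integral, uniformly in `k`, so the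
-- limits in `N` and `k` can be exchanged.
lemma tendsto_integral_of_approx
    {π : ℕ → Measure X} {ρ : Measure X} {W : X → ℝ} (hWπ : ∀ k, Integrable W (π k))
    (hWρ : Integrable W ρ) {M : ℝ} (hM : ∀ k, ∫ z, W z ∂π k ≤ M) (hMρ : ∫ z, W z ∂ρ ≤ M)
    {ψ : X → ℝ} {T : ℕ → X → ℝ} (hψπ : ∀ k, Integrable ψ (π k)) (hψρ : Integrable ψ ρ)
    (hTπ : ∀ N k, Integrable (T N) (π k)) (hTρ : ∀ N, Integrable (T N) ρ)
    (hT : ∀ N, Tendsto (fun k => ∫ z, T N z ∂π k) atTop (𝓝 (∫ z, T N z ∂ρ)))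
    (happ : ∀ ε > 0, ∃ N, ∀ z, |ψ z - T N z| ≤ ε * W z) :
    Tendsto (fun k => ∫ z, ψ z ∂π k) atTop (𝓝 (∫ z, ψ z ∂ρ)) := by
  rw [Metric.tendsto_atTop]
  intro ε hε
  -- Two approximation errors and one convergence error, each at most `ε / 4`, leave room for the
  -- strict bound; the `+ 1` keeps the denominator positive.
  obtain ⟨N, hN⟩ := happ (ε / (4 * (|M| + 1))) (by positivity)
  have key : ∀ m : Measure X, Integrable W m → Integrable ψ m → Integrable (T N) m →
      ∫ z, W z ∂m ≤ M → |∫ z, ψ z ∂m - ∫ z, T N z ∂m| ≤ ε / 4 := by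
    intro m hW h1 h2 hWM
    rw [← integral_sub h1 h2]
    calc |∫ z, (ψ z - T N z) ∂m| ≤ ∫ z, |ψ z - T N z| ∂m := abs_integral_le_integral_abs
      _ ≤ ∫ z, ε / (4 * (|M| + 1)) * W z ∂m :=
        integral_mono (h1.sub h2).abs (hW.const_mul _) hN
      _ = ε / (4 * (|M| + 1)) * ∫ z, W z ∂m := integral_const_mul _ _
      _ ≤ ε / (4 * (|M| + 1)) * (|M| + 1) := by
        gcongr; linarith [le_abs_self M]
      _ = ε / 4 := by field_simp
  obtain ⟨K, hK⟩ := Metric.tendsto_atTop.1 (hT N) (ε / 4) (by positivity)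
  refine ⟨K, fun k hk => ?_⟩
  have h1 := key _ (hWπ k) (hψπ k) (hTπ N k) (hM k)
  have h2 := key _ hWρ hψρ (hTρ N) hMρ
  have h3 := hK k hk
  rw [Real.dist_eq] at h3 ⊢
  rw [abs_le] at h1 h2
  rw [abs_lt] at h3 ⊢
  constructor <;> linarith [h1.1, h1.2, h2.1, h2.2, h3.1, h3.2]

/-- Finite Borel measures are ordered as soon as their integrals of nonnegative bounded continuous
functions are. -/
lemma measure_le_of_forall_lintegral_le [HasOuterApproxClosed X] [BorelSpace X]
    {σ ρ : Measure X} [IsFiniteMeasure σ] [IsFiniteMeasure ρ] [σ.WeaklyRegular]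
    (h : ∀ f : X →ᵇ ℝ≥0, ∫⁻ z, f z ∂σ ≤ ∫⁻ z, f z ∂ρ) : σ ≤ ρ := by
  have hcl : ∀ A : Set X, IsClosed A → σ A ≤ ρ A := fun A hA =>
    le_of_tendsto_of_tendsto' (HasOuterApproxClosed.tendsto_lintegral_apprSeq hA σ)
      (HasOuterApproxClosed.tendsto_lintegral_apprSeq hA ρ) fun n => h _
  refine Measure.le_iff.2 fun A hA => ?_
  rw [hA.measure_eq_iSup_isClosed_of_ne_top (measure_ne_top σ A)]
  exact iSup₂_le fun K hK => iSup_le fun hKc => (hcl K hKc).trans (measure_mono hK)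

/-- A tight sequence of finite measures with bounded masses has a weakly convergent subsequence. -/
lemma exists_subseq_weak_limit {X : Type*} [MetricSpace X] [SecondCountableTopology X] [Nonempty X]
    [MeasurableSpace X] [BorelSpace X]
    (π : ℕ → Measure X) [∀ k, IsFiniteMeasure (π k)] {M : ℝ} (hM : ∀ k, (π k).real Set.univ ≤ M)
    (ht : ∀ ε : ℝ, 0 < ε → ∃ K, IsCompact K ∧ ∀ k, (π k).real Kᶜ ≤ ε) :
    ∃ (s : ℕ → ℕ) (ρ : Measure X), StrictMono s ∧ IsFiniteMeasure ρ ∧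
      ∀ f : X →ᵇ ℝ, Tendsto (fun k => ∫ z, f z ∂π (s k)) atTop (𝓝 (∫ z, f z ∂ρ)) := by
  let P : ℕ → FiniteMeasure X := fun k => ⟨π k, inferInstance⟩
  obtain ⟨a, -, s, hs, ha⟩ := tendsto_subseq_of_bounded
    (Metric.isBounded_Icc (0 : ℝ) M) (x := fun k => (π k).real Set.univ)
    (fun k => ⟨measureReal_nonneg, hM k⟩)
  have ha0 : 0 ≤ a := ge_of_tendsto' ha fun k => measureReal_nonneg
  have hmass : ∀ k, ((P k).mass : ℝ) = (π k).real Set.univ := fun k => rfl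
  have fin : ∀ (s : ℕ → ℕ) (Q : FiniteMeasure X), Tendsto (fun k => P (s k)) atTop (𝓝 Q) →
      ∀ f : X →ᵇ ℝ, Tendsto (fun k => ∫ z, f z ∂π (s k)) atTop (𝓝 (∫ z, f z ∂(Q : Measure X))) :=
    fun s Q h f => FiniteMeasure.tendsto_iff_forall_integral_tendsto.1 h f
  -- Prokhorov's theorem is applied to the normalized measures, which requires masses away from
  -- zero; vanishing limit mass is treated apart.
  rcases ha0.eq_or_lt with rfl | hapos
  · refine ⟨s, _, hs, inferInstance, fin s 0 (FiniteMeasure.tendsto_zero_of_tendsto_zero_mass ?_)⟩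
    rw [← NNReal.tendsto_coe]
    exact ha
  · obtain ⟨K₀, hK₀⟩ := eventually_atTop.1 (ha.eventually (lt_mem_nhds (half_lt_self hapos)))
    let t : ℕ → ℕ := fun k => s (k + K₀)
    have htm : StrictMono t := fun i j hij => hs (by omega)
    have hta : Tendsto (fun k => (π (t k)).real Set.univ) atTop (𝓝 a) :=
      ha.comp (tendsto_add_atTop_nat K₀)
    have hlow : ∀ k, a / 2 < (π (t k)).real Set.univ := fun k => hK₀ _ (by omega)
    have hne : ∀ k, P (t k) ≠ 0 := fun k h0 => by
      have := hlow k
      rw [← hmass, h0] at this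
      simp at this
      linarith
    have htight : IsTightMeasureSet
        {((μ : ProbabilityMeasure X) : Measure X) | μ ∈ Set.range fun k => (P (t k)).normalize} := by
      rw [isTightMeasureSet_iff_exists_isCompact_measure_compl_le]
      intro ε hε
      by_cases hεt : ε = ⊤
      · exact ⟨∅, isCompact_empty, fun _ _ => hεt ▸ le_top⟩
      -- Normalizing divides by a mass larger than `a / 2`, which turns this bound into `ε`.
      obtain ⟨K, hK, hKle⟩ := ht (a / 2 * ε.toReal)
        (mul_pos (by positivity) (ENNReal.toReal_pos hε.ne' hεt))
      refine ⟨K, hK, ?_⟩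
      rintro _ ⟨_, ⟨k, rfl⟩, rfl⟩
      rw [← ENNReal.ofReal_toReal hεt]
      refine (ENNReal.le_ofReal_iff_toReal_le (measure_ne_top _ _) ENNReal.toReal_nonneg).2 ?_
      have h1 : ((((P (t k)).normalize : ProbabilityMeasure X) : Measure X) Kᶜ).toReal
          = ((P (t k)).mass : ℝ)⁻¹ * (π (t k)).real Kᶜ := by
        have := (P (t k)).normalize_eq_of_nonzero (hne k) Kᶜ
        have h2 := congrArg ((↑) : ℝ≥0 → ℝ) this
        rw [NNReal.coe_mul, NNReal.coe_inv] at h2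
        exact h2
      rw [h1, hmass, inv_mul_le_iff₀ ((half_pos hapos).trans (hlow k))]
      refine (hKle _).trans ?_
      gcongr
      exact (hlow k).le
    obtain ⟨Q, -, r, hr, hQ⟩ := (isCompact_closure_of_isTightMeasureSet htight).tendsto_subseq
      (fun k => subset_closure (Set.mem_range_self k))
    let A : ℝ≥0 := ⟨a, ha0⟩
    have hA : A ≠ 0 := fun h => hapos.ne' (congrArg NNReal.toReal h)
    let R : FiniteMeasure X := A • Q.toFiniteMeasure
    refine ⟨t ∘ r, _, htm.comp hr, inferInstance, fin (t ∘ r) R ?_⟩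
    have hQ' : Tendsto (fun k => (P (t (r k))).normalize.toFiniteMeasure) atTop
        (𝓝 Q.toFiniteMeasure) :=
      (ProbabilityMeasure.toFiniteMeasure_continuous.tendsto Q).comp hQ
    have hm : Tendsto (fun k => (P (t (r k))).mass) atTop (𝓝 A) := by
      rw [← NNReal.tendsto_coe]
      exact hta.comp hr.tendsto_atTop
    have := hm.smul hQ'
    refine this.congr fun k => ?_
    exact ((P (t (r k))).self_eq_mass_smul_normalize).symm

end WeakLimits

/-! ### Measures on a product and concentration -/

section Product

variable {E F : Type*} [MetricSpace E] [SecondCountableTopology E] [Nonempty E]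
  [MeasurableSpace E] [BorelSpace E]
  [MetricSpace F] [SecondCountableTopology F] [MeasurableSpace F] [BorelSpace F]

omit [Nonempty E] in
/-- Weak convergence of measures with a fixed first marginal can be tested against functions that
are merely measurable in the first variable. -/
lemma tendsto_integral_mul_of_fst_eq {π : ℕ → Measure (E × F)} [∀ k, IsFiniteMeasure (π k)]
    {ρ : Measure (E × F)} [IsFiniteMeasure ρ] {m : Measure E} [IsFiniteMeasure m]
    (hfst : ∀ k, (π k).fst = m) (hρ : ρ.fst = m)
    (hπ : ∀ f : E × F →ᵇ ℝ, Tendsto (fun k => ∫ z, f z ∂π k) atTop (𝓝 (∫ z, f z ∂ρ)))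
    {g : E → ℝ} (hg : Measurable g) {G : ℝ} (hG : ∀ x, |g x| ≤ G) (f : F →ᵇ ℝ) :
    Tendsto (fun k => ∫ z, g z.1 * f z.2 ∂π k) atTop (𝓝 (∫ z, g z.1 * f z.2 ∂ρ)) := by
  have hgi : Integrable g m := Integrable.of_bound hg.aestronglyMeasurable G (.of_forall hG)
  rw [Metric.tendsto_atTop]
  intro ε hε
  -- Replacing `g` by a continuous `φ` costs at most `‖f‖` times their distance in `L¹(m)`, the same
  -- for every measure with first marginal `m`.
  obtain ⟨φ, hφ, hφi⟩ := hgi.exists_boundedContinuous_integral_sub_le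
    (ε := ε / (4 * (‖f‖ + 1))) (by positivity)
  let Φ : E × F →ᵇ ℝ := φ.compContinuous ⟨Prod.fst, continuous_fst⟩ *
    f.compContinuous ⟨Prod.snd, continuous_snd⟩
  have hΦ : ∀ z, Φ z = φ z.1 * f z.2 := fun z => rfl
  have hfm : Measurable fun z : E × F => f z.2 := f.continuous.measurable.comp measurable_snd
  have key : ∀ τ : Measure (E × F), IsFiniteMeasure τ → τ.fst = m →
      |∫ z, g z.1 * f z.2 ∂τ - ∫ z, Φ z ∂τ| ≤ ε / 4 := by
    intro τ _ hτ
    have h1 : Integrable (fun z => g z.1 * f z.2) τ := by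
      refine Integrable.of_bound ((hg.comp measurable_fst).mul hfm).aestronglyMeasurable
        (G * ‖f‖) (.of_forall fun z => ?_)
      rw [norm_mul]
      exact mul_le_mul (hG _) (f.norm_coe_le_norm _) (norm_nonneg _) ((abs_nonneg _).trans (hG z.1))
    have h2 : Integrable (fun z : E × F => |g z.1 - φ z.1|) τ := by
      have : Integrable (fun x => |g x - φ x|) τ.fst := hτ ▸ (hgi.sub hφi).abs
      exact this.comp_measurable measurable_fst
    rw [← integral_sub h1 (Φ.integrable τ)]
    calc |∫ z, (g z.1 * f z.2 - Φ z) ∂τ| ≤ ∫ z, |g z.1 * f z.2 - Φ z| ∂τ :=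
          abs_integral_le_integral_abs
      _ ≤ ∫ z, |g z.1 - φ z.1| * ‖f‖ ∂τ := by
        refine integral_mono (h1.sub (Φ.integrable τ)).abs (h2.mul_const _) fun z => ?_
        simp only [hΦ]
        rw [← sub_mul, abs_mul]
        exact mul_le_mul_of_nonneg_left (f.norm_coe_le_norm _) (abs_nonneg _)
      _ = (∫ x, |g x - φ x| ∂m) * ‖f‖ := by
        rw [integral_mul_const, ← hτ, Measure.fst, integral_map measurable_fst.aemeasurable]
        exact (by fun_prop : Measurable fun x => |g x - φ x|).aestronglyMeasurable
      _ ≤ ε / (4 * (‖f‖ + 1)) * (‖f‖ + 1) := by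
        gcongr
        · exact hφ
        · linarith
      _ = ε / 4 := by field_simp
  obtain ⟨K, hK⟩ := Metric.tendsto_atTop.1 (hπ Φ) (ε / 4) (by positivity)
  refine ⟨K, fun k hk => ?_⟩
  have h1 := key _ inferInstance (hfst k)
  have h2 := key _ inferInstance hρ
  have h3 := hK k hk
  rw [Real.dist_eq] at h3 ⊢
  rw [abs_le] at h1 h2
  rw [abs_lt] at h3 ⊢
  constructor <;> linarith [h1.1, h1.2, h2.1, h2.2, h3.1, h3.2]

omit [SecondCountableTopology E] [Nonempty E] [SecondCountableTopology F] [BorelSpace F] in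
-- Test functions of the first variable alone have constant integrals along the sequence, and they
-- determine the marginal.
lemma fst_eq_of_weak_limit {π : ℕ → Measure (E × F)} {ρ : Measure (E × F)} [IsFiniteMeasure ρ]
    {m : Measure E} [IsFiniteMeasure m] (hfst : ∀ k, (π k).fst = m)
    (hπ : ∀ f : E × F →ᵇ ℝ, Tendsto (fun k => ∫ z, f z ∂π k) atTop (𝓝 (∫ z, f z ∂ρ))) :
    ρ.fst = m := by
  have hmap : ∀ (τ : Measure (E × F)) (φ : E →ᵇ ℝ), ∫ x, φ x ∂τ.fst = ∫ z, φ z.1 ∂τ := fun τ φ =>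
    integral_map measurable_fst.aemeasurable φ.continuous.measurable.aestronglyMeasurable
  refine ext_of_forall_integral_eq_of_IsFiniteMeasure fun φ => ?_
  refine tendsto_nhds_unique ?_ (tendsto_const_nhds (f := (atTop : Filter ℕ)))
  refine (hπ (φ.compContinuous ⟨Prod.fst, continuous_fst⟩)).congr' ?_ |>.trans_eq ?_
  · exact .of_forall fun k => by rw [← hfst k, hmap]; rfl
  · rw [hmap]; rfl

/-- The marginal in `E` of the measure `H(y) dπ(x, y)`. -/
noncomputable def densityMarginal (π : Measure (E × F)) (H : F → ℝ) : Measure E :=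
  (π.withDensity fun z => ENNReal.ofReal (H z.2)).map Prod.fst

omit [SecondCountableTopology E] [Nonempty E] [MetricSpace E] [BorelSpace E] [MetricSpace F]
  [SecondCountableTopology F] [BorelSpace F] in
lemma isFiniteMeasure_densityMarginal {π : Measure (E × F)} {H : F → ℝ}
    (hi : Integrable (fun z => H z.2) π) :
    IsFiniteMeasure (densityMarginal π H) := by
  have := isFiniteMeasure_withDensity_ofReal hi.2
  unfold densityMarginal
  infer_instance

omit [SecondCountableTopology E] [Nonempty E] [SecondCountableTopology F] in
lemma integral_densityMarginal {π : Measure (E × F)} {H : F → ℝ} (hH : Continuous H)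
    (h0 : ∀ y, 0 ≤ H y) {φ : E → ℝ} (hφ : Continuous φ) :
    ∫ x, φ x ∂densityMarginal π H = ∫ z, φ z.1 * H z.2 ∂π := by
  unfold densityMarginal
  rw [integral_map measurable_fst.aemeasurable hφ.measurable.aestronglyMeasurable,
    integral_withDensity_eq_integral_toReal_smul
      (f := fun z : E × F => ENNReal.ofReal (H z.2))
      (hH.measurable.comp measurable_snd).ennreal_ofReal (.of_forall fun _ => ENNReal.ofReal_lt_top)]
  refine integral_congr_ae (.of_forall fun z => ?_)
  simp [ENNReal.toReal_ofReal (h0 z.2), mul_comm]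

/-- If the mass of `H(y) dπ_k(x, y)` stays bounded, the part of it lost in the weak limit is
recorded, along a subsequence, by a concentration measure. -/
lemma exists_concentration_measure {π : ℕ → Measure (E × F)} [∀ k, IsFiniteMeasure (π k)]
    {ρ : Measure (E × F)} [IsFiniteMeasure ρ]
    (hπ : ∀ f : E × F →ᵇ ℝ, Tendsto (fun k => ∫ z, f z ∂π k) atTop (𝓝 (∫ z, f z ∂ρ)))
    {H : F → ℝ} (hH : Continuous H) (h0 : ∀ y, 0 ≤ H y)
    (hi : ∀ k, Integrable (fun z => H z.2) (π k)) {C : ℝ} (hC : ∀ k, ∫ z, H z.2 ∂π k ≤ C)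
    {K : Set E} (hK : IsCompact K) (hKπ : ∀ k, (π k).fst Kᶜ = 0) :
    ∃ (s : ℕ → ℕ) (μ : Measure E), StrictMono s ∧ IsFiniteMeasure μ ∧ μ Kᶜ = 0 ∧
      Integrable (fun z => H z.2) ρ ∧
      ∀ φ : E →ᵇ ℝ, Tendsto (fun k => ∫ z, φ z.1 * H z.2 ∂π (s k)) atTop
        (𝓝 (∫ z, φ z.1 * H z.2 ∂ρ + ∫ x, φ x ∂μ)) := by
  have hHc : Continuous fun z : E × F => H z.2 := hH.comp continuous_snd
  have hiρ := (integrable_and_integral_le_of_weak_limit hπ hHc (fun z => h0 _) hi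
    tendsto_const_nhds hC).1
  have hfin : ∀ k, IsFiniteMeasure (densityMarginal (π k) H) := fun k =>
    isFiniteMeasure_densityMarginal (hi k)
  have := isFiniteMeasure_densityMarginal hiρ
  have hsupp : ∀ k, densityMarginal (π k) H Kᶜ = 0 := fun k => by
    unfold densityMarginal
    rw [Measure.map_apply measurable_fst hK.measurableSet.compl]
    refine withDensity_absolutelyContinuous _ _ ?_
    have := hKπ k
    rwa [Measure.fst_apply hK.measurableSet.compl] at this
  obtain ⟨s, τ, hs, hτ, hlim⟩ := exists_subseq_weak_limit (fun k => densityMarginal (π k) H)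
    (M := C) (fun k => by
      have := integral_densityMarginal (π := π k) hH h0 (φ := fun _ => 1) continuous_const
      simp only [integral_const, smul_eq_mul, mul_one, one_mul] at this
      exact this.trans_le (hC k))
    (fun ε hε => ⟨K, hK, fun k => by simp [Measure.real, hsupp k, hε.le]⟩)
  have hlim' : ∀ φ : E →ᵇ ℝ, Tendsto (fun k => ∫ z, φ z.1 * H z.2 ∂π (s k)) atTop
      (𝓝 (∫ x, φ x ∂τ)) := fun φ => by
    simpa only [integral_densityMarginal hH h0 φ.continuous] using hlim φ
  -- For continuous `φ ≥ 0` this is lower semicontinuity applied to `φ(x) * H(y)`.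
  have hle : densityMarginal ρ H ≤ τ := by
    refine measure_le_of_forall_lintegral_le fun f => ?_
    rw [← ENNReal.toReal_le_toReal (f.lintegral_lt_top_of_nnreal _).ne
      (f.lintegral_lt_top_of_nnreal _).ne,
      BoundedContinuousFunction.toReal_lintegral_coe_eq_integral,
      BoundedContinuousFunction.toReal_lintegral_coe_eq_integral]
    let φ : E →ᵇ ℝ := BoundedContinuousFunction.comp _ NNReal.isometry_coe.lipschitz f
    have hφ : ∀ x, φ x = f x := fun x => rfl
    simp only [← hφ]
    rw [integral_densityMarginal hH h0 φ.continuous]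
    refine (integrable_and_integral_le_of_weak_limit (fun g => (hπ g).comp hs.tendsto_atTop)
      ((φ.continuous.comp continuous_fst).mul hHc) (fun z => mul_nonneg (f z.1).coe_nonneg (h0 _))
      (fun k => ?_) (hlim' φ) fun k => le_rfl).2
    refine (hi (s k)).bdd_mul (c := ‖φ‖)
      (φ.continuous.comp continuous_fst).measurable.aestronglyMeasurable
      (.of_forall fun z => φ.norm_coe_le_norm _)
  have hsub : τ - densityMarginal ρ H + densityMarginal ρ H = τ :=
    Measure.sub_add_cancel_of_le hle
  -- The approximating measures carry all their mass on the closed set `K` and total masses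
  -- converge, so the portmanteau inequality gives `τ univ ≤ τ K`.
  have hτK : τ Kᶜ = 0 := by
    let Q : FiniteMeasure E := ⟨τ, hτ⟩
    let T : ℕ → FiniteMeasure E := fun k => ⟨densityMarginal (π (s k)) H, hfin _⟩
    have hT : Tendsto T atTop (𝓝 Q) :=
      FiniteMeasure.tendsto_of_forall_integral_tendsto hlim
    have hlimsup := FiniteMeasure.limsup_measure_closed_le_of_tendsto hT hK.isClosed
    have hmass : Tendsto (fun k => (T k : Measure E) K) atTop (𝓝 (τ Set.univ)) := by
      change Tendsto _ _ (𝓝 ((Q : Measure E) Set.univ))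
      have h1 : Tendsto (fun k => (((T k).mass : ℝ≥0) : ℝ≥0∞)) atTop
          (𝓝 ((Q.mass : ℝ≥0) : ℝ≥0∞)) :=
        ENNReal.tendsto_coe.2 hT.mass
      rw [FiniteMeasure.ennreal_mass] at h1
      refine h1.congr fun k => ?_
      rw [FiniteMeasure.ennreal_mass, ← measure_add_measure_compl hK.measurableSet,
        show (T k : Measure E) Kᶜ = 0 from hsupp (s k), add_zero]
    rw [hmass.limsup_eq] at hlimsup
    rw [measure_compl hK.measurableSet (measure_ne_top _ _)]
    exact tsub_eq_zero_of_le hlimsup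
  refine ⟨s, τ - densityMarginal ρ H, hs, inferInstance, ?_, hiρ, fun φ => ?_⟩
  · exact le_antisymm ((Measure.sub_le Kᶜ).trans_eq hτK) bot_le
  · convert hlim' φ using 2
    rw [← integral_densityMarginal hH h0 φ.continuous, add_comm]
    conv_rhs => rw [← hsub]
    exact (integral_add_measure (φ.integrable _) (φ.integrable _)).symm

end Product

/-! ### Truncation relative to a growth weight -/

section Growth

variable {F : Type*} [NormedAddCommGroup F]

/-- Truncation of a function at the levels `-N` and `N`. -/
noncomputable def truncate (f : F → ℝ) (hf : Continuous f) (N : ℕ) : F →ᵇ ℝ :=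
  BoundedContinuousFunction.ofNormedAddCommGroup (fun y => max (-(N : ℝ)) (min N (f y)))
    (by fun_prop) N fun y => by
      have : (0 : ℝ) ≤ N := Nat.cast_nonneg N
      rw [Real.norm_eq_abs, abs_le]
      exact ⟨le_max_left _ _, max_le (by linarith) (min_le_left _ _)⟩

lemma truncate_apply (f : F → ℝ) (hf : Continuous f) (N : ℕ) (y : F) :
    truncate f hf N y = max (-(N : ℝ)) (min N (f y)) := rfl

lemma abs_sub_truncate_le (f : F → ℝ) (hf : Continuous f) (N : ℕ) (y : F) :
    |f y - truncate f hf N y| ≤ |f y| := by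
  have : (0 : ℝ) ≤ N := Nat.cast_nonneg N
  rw [truncate_apply]
  rcases max_cases (-(N : ℝ)) (min N (f y)) with h | h <;>
  rcases min_cases (N : ℝ) (f y) with h' | h' <;>
  rcases abs_cases (f y) with h'' | h'' <;>
  rw [h.1, abs_le] <;> constructor <;> linarith

lemma truncate_eq_self {f : F → ℝ} (hf : Continuous f) {N : ℕ} {y : F} (h : |f y| ≤ N) :
    truncate f hf N y = f y := by
  rw [truncate_apply, min_eq_right (abs_le.1 h).2, max_eq_right (abs_le.1 h).1]

/-- A continuous function of growth lower than `W` is uniformly approximated by its truncations,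
relative to `W`. -/
lemma exists_abs_sub_truncate_le [ProperSpace F] {f W : F → ℝ} (hf : Continuous f)
    (hW : ∀ y, 0 < W y)
    (hlim : Tendsto (fun y => |f y| / W y) (Bornology.cobounded F) (𝓝 0)) {ε : ℝ} (hε : 0 < ε) :
    ∃ N, ∀ y, |f y - truncate f hf N y| ≤ ε * W y := by
  -- Outside a compact set the truncation error is at most `|f| ≤ ε * W`; on that set `f` is
  -- bounded, and a high enough level makes no error.
  have h1 : ∀ᶠ y in Bornology.cobounded F, |f y| ≤ ε * W y := by
    filter_upwards [hlim.eventually (gt_mem_nhds hε)] with y hy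
    exact ((div_lt_iff₀ (hW y)).1 hy).le
  rw [Metric.cobounded_eq_cocompact, Filter.Eventually, mem_cocompact] at h1
  obtain ⟨K, hK, hKs⟩ := h1
  obtain ⟨B, hB⟩ := hK.exists_bound_of_continuousOn hf.continuousOn
  obtain ⟨N, hN⟩ := exists_nat_ge B
  refine ⟨N, fun y => ?_⟩
  by_cases hy : y ∈ K
  · rw [truncate_eq_self hf ((hB y hy).trans hN), sub_self, abs_zero]
    exact mul_nonneg hε.le (hW y).le
  · exact (abs_sub_truncate_le f hf N y).trans (hKs hy)

/-- Continuous functions of lower growth than `W` are integrable wherever `W` is. -/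
lemma integrable_of_lower_growth [ProperSpace F] {X : Type*} [MeasurableSpace X] {m : Measure X}
    [IsFiniteMeasure m] {v : X → F} {f W : F → ℝ} (hf : Continuous f)
    (hW : ∀ y, 0 < W y)
    (hlim : Tendsto (fun y => |f y| / W y) (Bornology.cobounded F) (𝓝 0))
    (hv : AEStronglyMeasurable v m) (hWv : Integrable (fun x => W (v x)) m) :
    Integrable (fun x => f (v x)) m := by
  obtain ⟨N, hN⟩ := exists_abs_sub_truncate_le hf hW hlim one_pos
  have hT := (truncate f hf N).continuous.comp_aestronglyMeasurable hv
  have h1 : Integrable (fun x => truncate f hf N (v x)) m :=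
    Integrable.of_bound hT ‖truncate f hf N‖
      (.of_forall fun x => (truncate f hf N).norm_coe_le_norm _)
  have h2 : Integrable (fun x => f (v x) - truncate f hf N (v x)) m :=
    hWv.mono' ((hf.comp_aestronglyMeasurable hv).sub hT)
      (.of_forall fun x => (hN (v x)).trans_eq (one_mul _))
  exact (h1.add h2).congr (.of_forall fun x => by simp)

end Growth

/-! ### Limits of lower growth, disintegration and tightness -/

/-- The Young measure theorem for weakly convergent measures on a product. -/
lemma tendsto_integral_of_lower_growth {E F : Type*} [MetricSpace E] [SecondCountableTopology E]
    [MeasurableSpace E] [BorelSpace E] [NormedAddCommGroup F] [ProperSpace F]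
    [SecondCountableTopology F] [MeasurableSpace F] [BorelSpace F]
    {π : ℕ → Measure (E × F)} [∀ k, IsFiniteMeasure (π k)]
    {ρ : Measure (E × F)} [IsFiniteMeasure ρ] {m : Measure E} [IsFiniteMeasure m]
    (hfst : ∀ k, (π k).fst = m) (hρ : ρ.fst = m)
    (hπ : ∀ f : E × F →ᵇ ℝ, Tendsto (fun k => ∫ z, f z ∂π k) atTop (𝓝 (∫ z, f z ∂ρ)))
    {W : F → ℝ} (hWc : Continuous W) (hW : ∀ y, 0 < W y)
    (hi : ∀ k, Integrable (fun z => W z.2) (π k)) {C : ℝ} (hC : ∀ k, ∫ z, W z.2 ∂π k ≤ C)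
    {f : F → ℝ} (hf : Continuous f)
    (hlim : Tendsto (fun y => |f y| / W y) (Bornology.cobounded F) (𝓝 0))
    {g : E → ℝ} (hg : Measurable g) {G : ℝ} (hG : ∀ x, |g x| ≤ G) :
    Tendsto (fun k => ∫ z, g z.1 * f z.2 ∂π k) atTop (𝓝 (∫ z, g z.1 * f z.2 ∂ρ)) := by
  obtain ⟨hiρ, hCρ⟩ := integrable_and_integral_le_of_weak_limit hπ (hWc.comp continuous_snd)
    (fun z => (hW _).le) hi tendsto_const_nhds hC
  have hsnd : ∀ τ : Measure (E × F), AEStronglyMeasurable Prod.snd τ := fun τ =>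
    measurable_snd.aestronglyMeasurable
  have hgi : ∀ (τ : Measure (E × F)) (q : E × F → ℝ), Integrable q τ →
      Integrable (fun z => g z.1 * q z) τ := fun τ q hq =>
    hq.bdd_mul (c := G) (hg.comp measurable_fst).aestronglyMeasurable (.of_forall fun z => hG _)
  have hTi : ∀ (τ : Measure (E × F)) [IsFiniteMeasure τ] (N : ℕ),
      Integrable (fun z => truncate f hf N z.2) τ := fun τ _ N =>
    Integrable.of_bound ((truncate f hf N).continuous.comp_aestronglyMeasurable (hsnd τ))
      ‖truncate f hf N‖ (.of_forall fun x => (truncate f hf N).norm_coe_le_norm _)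
  refine tendsto_integral_of_approx hi hiρ hC hCρ (T := fun N z => g z.1 * truncate f hf N z.2)
    (fun k => hgi _ _ (integrable_of_lower_growth hf hW hlim (hsnd _) (hi k)))
    (hgi _ _ (integrable_of_lower_growth hf hW hlim (hsnd _) hiρ))
    (fun N k => hgi _ _ (hTi _ N)) (fun N => hgi _ _ (hTi _ N))
    (fun N => tendsto_integral_mul_of_fst_eq hfst hρ hπ hg hG _) fun ε hε => ?_
  obtain ⟨N, hN⟩ := exists_abs_sub_truncate_le hf hW hlim (ε := ε / (|G| + 1)) (by positivity)
  refine ⟨N, fun z => ?_⟩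
  rw [← mul_sub, abs_mul]
  calc |g z.1| * |f z.2 - truncate f hf N z.2| ≤ (|G| + 1) * (ε / (|G| + 1) * W z.2) := by
        gcongr
        · linarith [hG z.1, le_abs_self G]
        · exact hN _
    _ = ε * W z.2 := by field_simp

/-- Integration of functions of the second variable by disintegration. -/
lemma integral_mul_eq_integral_condKernel {E F : Type*} [MeasurableSpace E]
    [MeasurableSpace F] [StandardBorelSpace F] [Nonempty F]
    {ρ : Measure (E × F)} [IsFiniteMeasure ρ] {q : F → ℝ}
    (hq : Integrable (fun z => q z.2) ρ) :
    (∀ᵐ x ∂ρ.fst, Integrable q (ρ.condKernel x)) ∧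
      Integrable (fun x => ∫ y, q y ∂ρ.condKernel x) ρ.fst ∧
      ∀ (g : E → ℝ) (G : ℝ), Measurable g → (∀ x, |g x| ≤ G) →
        ∫ z, g z.1 * q z.2 ∂ρ = ∫ x, (∫ y, q y ∂ρ.condKernel x) * g x ∂ρ.fst := by
  have hd : ρ.fst ⊗ₘ ρ.condKernel = ρ := ρ.disintegrate ρ.condKernel
  refine ⟨hq.condKernel_ae, hq.integral_condKernel, fun g G hg hG => ?_⟩
  have hgq : Integrable (fun z : E × F => g z.1 * q z.2) ρ :=
    hq.bdd_mul (c := G) (hg.comp measurable_fst).aestronglyMeasurable (.of_forall fun z => hG _)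
  conv_lhs => rw [← hd]
  rw [← hd] at hgq
  rw [Measure.integral_compProd hgq]
  refine integral_congr_ae (.of_forall fun x => ?_)
  simp only []
  rw [integral_const_mul, mul_comm]

/-- An essentially bounded function agrees almost everywhere with a bounded measurable one. -/
lemma MeasureTheory.MemLp.exists_measurable_bounded_ae_eq {E : Type*} [MeasurableSpace E]
    {m : Measure E} {g : E → ℝ} (hg : MemLp g ⊤ m) :
    ∃ (g' : E → ℝ) (G : ℝ), Measurable g' ∧ (∀ x, |g' x| ≤ G) ∧ g =ᵐ[m] g' := by
  let B : ℝ := (eLpNorm g ⊤ m).toReal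
  have hB : 0 ≤ B := ENNReal.toReal_nonneg
  have hgB : ∀ᵐ x ∂m, |g x| ≤ B := by
    have := ae_le_eLpNormEssSup (f := g) (μ := m)
    filter_upwards [this] with x hx
    rw [← eLpNorm_exponent_top] at hx
    have := ENNReal.toReal_mono hg.2.ne hx
    rwa [toReal_enorm, Real.norm_eq_abs] at this
  -- Clamping a measurable representative makes the essential bound hold everywhere and changes it
  -- only on a null set.
  refine ⟨fun x => max (-B) (min B (hg.1.mk g x)), B, ?_, fun x => ?_, ?_⟩
  · exact measurable_const.max (measurable_const.min hg.1.stronglyMeasurable_mk.measurable)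
  · exact abs_le.2 ⟨le_max_left _ _, max_le (by linarith) (min_le_left _ _)⟩
  · filter_upwards [hg.1.ae_eq_mk, hgB] with x h1 h2
    rw [← h1, min_eq_right (abs_le.1 h2).2, max_eq_right (abs_le.1 h2).1]

/-- A continuous function on a compact set extends to a bounded continuous function. -/
lemma exists_boundedContinuous_eqOn {E : Type*} [TopologicalSpace E] [T2Space E] [NormalSpace E]
    {K : Set E} (hK : IsCompact K) {φ : E → ℝ} (hφ : ContinuousOn φ K) :
    ∃ Φ : E →ᵇ ℝ, Set.EqOn Φ φ K := by
  have := isCompact_iff_compactSpace.1 hK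
  obtain ⟨Φ, -, hΦ⟩ := BoundedContinuousFunction.exists_norm_eq_domRestrict_eq_of_closed
    (BoundedContinuousFunction.mkOfCompact ⟨K.domRestrict φ, hφ.domRestrict⟩) hK.isClosed
  exact ⟨Φ, fun x hx => congrArg (fun f => f ⟨x, hx⟩) hΦ⟩

/-- Markov's inequality for `W` controls the mass at large `‖y‖`, while the first variable stays in
`K` almost surely. -/
lemma exists_isCompact_real_compl_le {E F : Type*} [TopologicalSpace E] [MeasurableSpace E]
    [NormedAddCommGroup F] [ProperSpace F] [MeasurableSpace F]
    {π : ℕ → Measure (E × F)} [∀ k, IsFiniteMeasure (π k)] {W : F → ℝ} (hW : ∀ y, ‖y‖ ≤ W y)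
    (hi : ∀ k, Integrable (fun z => W z.2) (π k)) {C : ℝ} (hC : ∀ k, ∫ z, W z.2 ∂π k ≤ C)
    {K : Set E} (hK : IsCompact K) (hKπ : ∀ k, π k (Prod.fst ⁻¹' Kᶜ) = 0)
    {ε : ℝ} (hε : 0 < ε) :
    ∃ L, IsCompact L ∧ ∀ k, (π k).real Lᶜ ≤ ε := by
  let R : ℝ := (|C| + 1) / ε
  have hR : 0 < R := by positivity
  refine ⟨K ×ˢ Metric.closedBall 0 R, hK.prod (isCompact_closedBall _ _), fun k => ?_⟩
  have hsub : (K ×ˢ Metric.closedBall (0 : F) R)ᶜ ⊆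
      Prod.fst ⁻¹' Kᶜ ∪ {z | R ≤ W z.2} := by
    rintro ⟨x, y⟩ h
    by_cases hx : x ∈ K
    · right
      by_contra hy
      exact h ⟨hx, mem_closedBall_zero_iff.2 ((hW y).trans (not_le.1 hy).le)⟩
    · exact Or.inl hx
  have h1 : R * (π k).real {z | R ≤ W z.2} ≤ C :=
    (mul_meas_ge_le_integral_of_nonneg (.of_forall fun z => (norm_nonneg _).trans (hW _))
      (hi k) R).trans (hC k)
  calc (π k).real (K ×ˢ Metric.closedBall (0 : F) R)ᶜ
      ≤ (π k).real (Prod.fst ⁻¹' Kᶜ ∪ {z | R ≤ W z.2}) := measureReal_mono hsub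
    _ ≤ (π k).real (Prod.fst ⁻¹' Kᶜ) + (π k).real {z | R ≤ W z.2} := measureReal_union_le _ _
    _ = (π k).real {z | R ≤ W z.2} := by rw [measureReal_def, hKπ k, ENNReal.toReal_zero, zero_add]
    _ ≤ C / R := by rwa [le_div_iff₀ hR, mul_comm]
    _ ≤ ε := by
      rw [div_le_iff₀ hR, mul_div_cancel₀ _ hε.ne']
      linarith [le_abs_self C]

/-! ### The graph measures of the sequence -/

theorem proposition2p1 (n d : ℕ)
    (Ω : Set (EuclideanSpace ℝ (Fin d))) (hΩo : IsOpen Ω) (hΩb : Bornology.IsBounded Ω)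
    (h : EuclideanSpace ℝ (Fin n) → ℝ) (hconv : ConvexOn ℝ Set.univ h)
    (p : ℝ) (hp : 1 ≤ p) (c : ℝ) (hc : 0 < c)
    (hgrowth : ∀ y, 1 / c * ‖y‖ ^ p - c ≤ h y)
    (u : ℕ → EuclideanSpace ℝ (Fin d) → EuclideanSpace ℝ (Fin n))
    (hmeas : ∀ j, AEStronglyMeasurable (u j) (volume.restrict Ω))
    (hbound : ∃ C : ℝ, ∀ j, IntegrableOn (fun x => h (u j x)) Ω volume ∧
      ∫ x in Ω, h (u j x) ≤ C) :
    ∃ (s : ℕ → ℕ) (ν : Kernel (EuclideanSpace ℝ (Fin d)) (EuclideanSpace ℝ (Fin n)))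
      (μ : Measure (EuclideanSpace ℝ (Fin d))),
      StrictMono s ∧ IsMarkovKernel ν ∧ IsFiniteMeasure μ ∧ μ (closure Ω)ᶜ = 0 ∧
      (∀ f : EuclideanSpace ℝ (Fin n) → ℝ, Continuous f →
        Tendsto (fun y => |f y| / (1 + ‖y‖ ^ p)) (Bornology.cobounded _) (𝓝 0) →
        (∀ᵐ x ∂(volume.restrict Ω), Integrable f (ν x)) ∧
        WeaklyConvergesInL1 (volume.restrict Ω) (fun k x => f (u (s k) x))
          (fun x => ∫ y, f y ∂(ν x))) ∧
      (∀ᵐ x ∂(volume.restrict Ω), Integrable h (ν x)) ∧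
      IntegrableOn (fun x => ∫ y, h y ∂(ν x)) Ω volume ∧
      (∀ φ : EuclideanSpace ℝ (Fin d) → ℝ, ContinuousOn φ (closure Ω) →
        Tendsto (fun k => ∫ x in Ω, h (u (s k) x) * φ x) atTop
          (𝓝 ((∫ x in Ω, (∫ y, h y ∂(ν x)) * φ x) + ∫ x in closure Ω, φ x ∂μ))) := by
  obtain ⟨C₀, hC₀⟩ := hbound
  have hΩcl : IsCompact (closure Ω) := hΩb.isCompact_closure
  have hΩm : MeasurableSet Ω := hΩo.measurableSet
  set m : Measure (EuclideanSpace ℝ (Fin d)) := volume.restrict Ω with hm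
  have : IsFiniteMeasure m := ⟨by simpa [hm] using hΩb.measure_lt_top⟩
  have hmΩ : m (closure Ω)ᶜ = 0 := by
    rw [hm, Measure.restrict_apply isClosed_closure.measurableSet.compl,
      ((disjoint_compl_left (a := closure Ω)).mono_right subset_closure).inter_eq, measure_empty]
  -- Convexity enters only here, through continuity.
  have hcont : Continuous h :=
    continuousOn_univ.1 (hconv.continuousOn isOpen_univ)
  -- the shifted integrand is nonnegative and controls the weight
  let H : EuclideanSpace ℝ (Fin n) → ℝ := fun y => h y + c
  let W : EuclideanSpace ℝ (Fin n) → ℝ := fun y => 1 + ‖y‖ ^ p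
  have hHc : Continuous H := hcont.add continuous_const
  have hWc : Continuous W := continuous_const.add
    (continuous_norm.rpow_const fun _ => Or.inr (zero_le_one.trans hp))
  have hp0 : ∀ y : EuclideanSpace ℝ (Fin n), 0 ≤ ‖y‖ ^ p := fun y =>
    Real.rpow_nonneg (norm_nonneg y) p
  have hWH : ∀ y, W y ≤ 1 + c * H y := fun y => by
    have h1 : 1 / c * ‖y‖ ^ p ≤ H y := by linarith [hgrowth y]
    have h2 := mul_le_mul_of_nonneg_left h1 hc.le
    rw [← mul_assoc, mul_one_div_cancel hc.ne', one_mul] at h2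
    exact add_le_add_right h2 1
  have hH0 : ∀ y, 0 ≤ H y := fun y => by
    have : 0 ≤ 1 / c * ‖y‖ ^ p := mul_nonneg (by positivity) (hp0 y)
    linarith [hgrowth y]
  have hW0 : ∀ y, 0 < W y := fun y => add_pos_of_pos_of_nonneg one_pos (hp0 y)
  have hWn : ∀ y, ‖y‖ ≤ W y := fun y => by
    rcases le_total ‖y‖ 1 with hy | hy
    · exact hy.trans (le_add_of_nonneg_right (hp0 y))
    · have := Real.self_le_rpow_of_one_le hy hp
      exact this.trans (le_add_of_nonneg_left zero_le_one)
  -- the measures carried by the graphs of the functions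
  have hpair : ∀ j, AEMeasurable (fun x => (x, u j x)) m := fun j =>
    aemeasurable_id.prodMk (hmeas j).aemeasurable
  let π : ℕ → Measure (EuclideanSpace ℝ (Fin d) × EuclideanSpace ℝ (Fin n)) := fun j =>
    m.map fun x => (x, u j x)
  have hπf : ∀ j, (π j).fst = m := fun j =>
    (Measure.fst_map_prodMk₀ (hmeas j).aemeasurable).trans Measure.map_id
  have hπi : ∀ j (q : _ → ℝ), Measurable q → ∫ z, q z ∂π j = ∫ x, q (x, u j x) ∂m :=
    fun j q hq => integral_map (hpair j) hq.aestronglyMeasurable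
  have hπI : ∀ j (q : _ → ℝ), Measurable q →
      (Integrable q (π j) ↔ Integrable (fun x => q (x, u j x)) m) :=
    fun j q hq => integrable_map_measure hq.aestronglyMeasurable (hpair j)
  have hHm : Measurable fun z : EuclideanSpace ℝ (Fin d) × EuclideanSpace ℝ (Fin n) => H z.2 :=
    hHc.measurable.comp measurable_snd
  have hWm : Measurable fun z : EuclideanSpace ℝ (Fin d) × EuclideanSpace ℝ (Fin n) => W z.2 :=
    hWc.measurable.comp measurable_snd
  have hHi : ∀ j, Integrable (fun z => H z.2) (π j) := fun j =>
    (hπI j _ hHm).2 ((hC₀ j).1.add (integrable_const c))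
  have hHC : ∀ j, ∫ z, H z.2 ∂π j ≤ C₀ + m.real Set.univ * c := fun j => by
    rw [hπi j _ hHm, integral_add (hC₀ j).1 (integrable_const c), integral_const, smul_eq_mul]
    exact add_le_add_left (hC₀ j).2 _
  have hWi : ∀ j, Integrable (fun z => W z.2) (π j) := fun j =>
    ((integrable_const 1).add ((hHi j).const_mul c)).mono' hWm.aestronglyMeasurable
      (.of_forall fun z => by
        rw [Real.norm_of_nonneg (hW0 _).le]
        exact hWH _)
  have hmass : ∀ j, (π j).real Set.univ = m.real Set.univ := fun j => by
    rw [← hπf j, measureReal_def, measureReal_def, Measure.fst_univ]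
  have hWC : ∀ j, ∫ z, W z.2 ∂π j ≤
      m.real Set.univ + c * (C₀ + m.real Set.univ * c) := fun j => by
    calc ∫ z, W z.2 ∂π j ≤ ∫ z, (1 + c * H z.2) ∂π j :=
          integral_mono (hWi j) ((integrable_const 1).add ((hHi j).const_mul c)) fun z => hWH _
      _ = m.real Set.univ + c * ∫ z, H z.2 ∂π j := by
          rw [integral_add (integrable_const 1) ((hHi j).const_mul c), integral_const_mul,
            integral_const, hmass, smul_eq_mul, mul_one]
      _ ≤ _ := by
          gcongr
          exact hHC j
  have hπK : ∀ j, (π j).fst (closure Ω)ᶜ = 0 := fun j => by rw [hπf, hmΩ]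
  obtain ⟨s₁, ρ, hs₁, hρfin, hρ⟩ := exists_subseq_weak_limit π (fun j => (hmass j).le)
    fun ε hε => exists_isCompact_real_compl_le hWn hWi hWC hΩcl (fun j => by
      rw [← Measure.fst_apply isClosed_closure.measurableSet.compl, hπK]) hε
  have hρf : ρ.fst = m := fst_eq_of_weak_limit (fun k => hπf (s₁ k)) hρ
  obtain ⟨s₂, μ, hs₂, hμfin, hμK, hHρ, hconc⟩ := exists_concentration_measure hρ hHc hH0
    (fun k => hHi (s₁ k)) (fun k => hHC (s₁ k)) hΩcl (fun k => hπK (s₁ k))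
  have hρ' : ∀ f : EuclideanSpace ℝ (Fin d) × EuclideanSpace ℝ (Fin n) →ᵇ ℝ,
      Tendsto (fun k => ∫ z, f z ∂π (s₁ (s₂ k))) atTop (𝓝 (∫ z, f z ∂ρ)) := fun f =>
    (hρ f).comp hs₂.tendsto_atTop
  have hWρ : Integrable (fun z => W z.2) ρ :=
    (integrable_and_integral_le_of_weak_limit hρ' (hWc.comp continuous_snd)
      (fun z => (hW0 _).le) (fun k => hWi _) tendsto_const_nhds fun k => hWC _).1
  have hhρ : Integrable (fun z => h z.2) ρ :=
    (hHρ.sub (integrable_const c)).congr (.of_forall fun z => by simp [H])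
  obtain ⟨hh1, hh2, hh3⟩ := integral_mul_eq_integral_condKernel hhρ
  rw [hρf] at hh1 hh2 hh3
  refine ⟨s₁ ∘ s₂, ρ.condKernel, μ, hs₁.comp hs₂, inferInstance, hμfin, hμK, fun f hf hlim => ?_,
    hh1, hh2, fun φ hφ => ?_⟩
  · have hfρ : Integrable (fun z => f z.2) ρ :=
      integrable_of_lower_growth hf hW0 hlim measurable_snd.aestronglyMeasurable hWρ
    obtain ⟨hf1, hf2, hf3⟩ := integral_mul_eq_integral_condKernel hfρ
    rw [hρf] at hf1 hf2 hf3
    refine ⟨hf1, fun k => ?_, hf2, fun g hg => ?_⟩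
    · exact integrable_of_lower_growth hf hW0 hlim (hmeas _) ((hπI _ _ hWm).1 (hWi _))
    · obtain ⟨g', G, hg', hG, hgg'⟩ := hg.exists_measurable_bounded_ae_eq
      have key := tendsto_integral_of_lower_growth (fun k => hπf (s₁ (s₂ k))) hρf hρ' hWc hW0
        (fun k => hWi _) (fun k => hWC _) hf hlim hg' hG
      rw [hf3 g' G hg' hG] at key
      have hlimit : ∫ x, (∫ y, f y ∂ρ.condKernel x) * g x ∂m =
          ∫ x, (∫ y, f y ∂ρ.condKernel x) * g' x ∂m :=
        integral_congr_ae (hgg'.mono fun x hx => by simp only [hx])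
      rw [hlimit]
      refine key.congr fun k => ?_
      refine (hπi _ (fun z => g' z.1 * f z.2)
        ((hg'.comp measurable_fst).mul (hf.measurable.comp measurable_snd))).trans ?_
      exact integral_congr_ae (hgg'.mono fun x hx => by simp [hx, mul_comm])
  -- By Tietze `φ` becomes a global test function; neither `m` nor `μ` charges the complement of
  -- `closure Ω`.
  · obtain ⟨Φ, hΦ⟩ := exists_boundedContinuous_eqOn hΩcl hφ
    have hmφ : ∀ q : EuclideanSpace ℝ (Fin d) → ℝ, ∫ x, q x * φ x ∂m = ∫ x, q x * Φ x ∂m :=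
      fun q => setIntegral_congr_fun hΩm fun x hx => by
        simp only [hΦ (subset_closure hx)]
    have hμae : ∀ᵐ x ∂μ, x ∈ closure Ω := mem_ae_iff.2 hμK
    have hμφ : ∫ x in closure Ω, φ x ∂μ = ∫ x, Φ x ∂μ := by
      rw [setIntegral_congr_fun isClosed_closure.measurableSet fun x hx => (hΦ hx).symm,
        Measure.restrict_eq_self_of_ae_mem hμae]
    have hΦb : ∀ {τ : Measure (EuclideanSpace ℝ (Fin d) × EuclideanSpace ℝ (Fin n))}
        {q : EuclideanSpace ℝ (Fin n) → ℝ}, Integrable (fun z => q z.2) τ →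
        Integrable (fun z => Φ z.1 * q z.2) τ := fun {τ q} hq =>
      hq.bdd_mul (c := ‖Φ‖) (Φ.continuous.measurable.comp measurable_fst).aestronglyMeasurable
        (.of_forall fun z => Φ.norm_coe_le_norm _)
    -- Passing from `H` back to `h` subtracts the same number for every measure with first marginal
    -- `m`, so the shift cancels in the limit.
    have hsplit : ∀ τ : Measure (EuclideanSpace ℝ (Fin d) × EuclideanSpace ℝ (Fin n)),
        IsFiniteMeasure τ → τ.fst = m → Integrable (fun z => H z.2) τ →
        ∫ z, Φ z.1 * h z.2 ∂τ = ∫ z, Φ z.1 * H z.2 ∂τ - c * ∫ x, Φ x ∂m := by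
      intro τ _ hτ hHτ
      have h1 : ∫ x, Φ x ∂m = ∫ z, Φ z.1 ∂τ := by
        rw [← hτ]
        exact integral_map measurable_fst.aemeasurable Φ.continuous.measurable.aestronglyMeasurable
      rw [h1, ← integral_const_mul, ← integral_sub (hΦb hHτ)
        (hΦb (q := fun _ => c) (integrable_const c) |>.congr (.of_forall fun z => mul_comm _ _))]
      exact integral_congr_ae (.of_forall fun z => by simp only [H]; ring)
    simp only [hmφ, hμφ]
    rw [← hh3 Φ ‖Φ‖ Φ.continuous.measurable fun x => Φ.norm_coe_le_norm x,
      hsplit ρ inferInstance hρf hHρ, sub_add_eq_add_sub]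
    refine ((hconc Φ).sub_const _).congr fun k => ?_
    rw [← hsplit _ inferInstance (hπf _) (hHi _)]
    refine (hπi _ (fun z => Φ z.1 * h z.2) ((Φ.continuous.measurable.comp measurable_fst).mul
      (hcont.measurable.comp measurable_snd))).trans ?_
    exact integral_congr_ae (.of_forall fun x => mul_comm _ _)
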